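/- All graphs are finite, simple, undirected and connected. Two vertices $x,y$ of a graph $G$ monitor an edge $e$ if $e$ belongs to all shortest paths between $x$ and $y$ in $G$. A set $S\subseteq V(G)$ is a monitoring edge-geodetic set (MEG-set) of $G$ if every edge of $G$ is monitored by some pair $x,y\in S$. Let $\mathrm{MEG}(G)$ be the minimum size of a MEG-set of $G$, let $\mathrm{fes}(G)$ be the minimum number of edges of $G$ whose removal leaves a forest, and let $L(G)$ be the set of leaves (vertices of degree $1$) of $G$. Theorem. If $\mathrm{fes}(G)\ge 2$, then $$\mathrm{MEG}(G)\le 9\,\mathrm{fes}(G)+|L(G)|-8.$$ -/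

import Mathlib

/-- A pair `x, y` of vertices monitors `e` if `y` can be reached from `x` and `e` lies on every
shortest path between `x` and `y`.  (A walk of length `G.dist x y` is a shortest path.) -/
def Monitors {V : Type*} (G : SimpleGraph V) (x y : V) (e : Sym2 V) : Prop :=
  G.Reachable x y ∧ ∀ p : G.Walk x y, p.length = G.dist x y → e ∈ p.edges

/-- A monitoring edge-geodetic set: every edge of `G` is monitored by a pair of vertices of `S`. -/
def IsMEGSet {V : Type*} (G : SimpleGraph V) (S : Finset V) : Prop :=
  ∀ e ∈ G.edgeSet, ∃ x ∈ S, ∃ y ∈ S, Monitors G x y e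

/-- The size of a smallest monitoring edge-geodetic set of `G`. -/
noncomputable def megNumber {V : Type*} (G : SimpleGraph V) : ℕ :=
  sInf {n : ℕ | ∃ S : Finset V, IsMEGSet G S ∧ S.card = n}

/-- A feedback edge set: a set of edges of `G` whose removal leaves a forest. -/
def IsFeedbackEdgeSet {V : Type*} (G : SimpleGraph V) (F : Finset (Sym2 V)) : Prop :=
  (F : Set (Sym2 V)) ⊆ G.edgeSet ∧ (G.deleteEdges (F : Set (Sym2 V))).IsAcyclic

/-- The feedback edge set number: the size of a smallest feedback edge set of `G`. -/
noncomputable def fesNumber {V : Type*} (G : SimpleGraph V) : ℕ :=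
  sInf {n : ℕ | ∃ F : Finset (Sym2 V), IsFeedbackEdgeSet G F ∧ F.card = n}

/-- The set of leaves of `G`, that is, of its vertices of degree 1. -/
def leafSet {V : Type*} [Fintype V] (G : SimpleGraph V) [DecidableRel G.Adj] : Finset V :=
  Finset.univ.filter fun v => G.degree v = 1

/-- The whole vertex set is a monitoring edge-geodetic set, so the minimum in `megNumber` is
attained for every finite graph. -/
theorem isMEGSet_univ {V : Type*} [Fintype V] (G : SimpleGraph V) :
    IsMEGSet G Finset.univ := by
  intro e
  induction e using Sym2.ind with
  | _ x y =>
    intro h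
    have h' : G.Adj x y := h
    refine ⟨x, Finset.mem_univ _, y, Finset.mem_univ _, h'.reachable, fun p hp => ?_⟩
    rw [SimpleGraph.dist_eq_one_iff_adj.mpr h'] at hp
    cases p with
    | nil => simp at hp
    | cons hxz q =>
      cases q with
      | nil => simp
      | cons _ _ => simp at hp

/-- The set of all edges is a feedback edge set, so the minimum in `fesNumber` is attained for
every finite graph. -/
theorem isFeedbackEdgeSet_edgeFinset {V : Type*} (G : SimpleGraph V) [Fintype G.edgeSet] :
    IsFeedbackEdgeSet G G.edgeFinset := by
  refine ⟨by simp, ?_⟩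
  have h : G.deleteEdges (G.edgeFinset : Set (Sym2 V)) = ⊥ := by
    ext a b
    simp
  rw [h]
  exact SimpleGraph.isAcyclic_bot

/-!
Let `k` be the feedback edge set number of `G`. The idea is to monitor the bridges with the leaves
and to monitor the remaining edges inside the *bridgeless part* `H` of `G`, the graph of all edges
that are not bridges.

A path of `G` between two vertices of one component of `H` uses no bridge
(`Walk.IsPath.mem_edgeSet_bridgelessPart`), so distances and shortest paths in a component of `H`
are those of `G`, and what is monitored in `H` is monitored in `G`. A bridge is monitored once
there are chosen vertices on both of its sides, and each side contains a leaf of `G` or an edge of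
`H` (`exists_leaf_or_bridgelessPart_adj`).

Let `K` consist of the vertices of degree at least three in `H` and of one vertex from each
component of `H` that is a cycle. Every edge of `H` lies on a cycle, which the vertices of `K` cut
into *threads* whose inner vertices have degree two (`exists_isThread`). A thread is determined by
its first two vertices, so there are at most as many oriented threads as edges leaving `K`. From
each end of a thread choose the middle vertex, rounded down towards that end. If the ends differ,
then the stretch from an end to the vertex chosen there is the only shortest path between these two
vertices, and at most one edge remains in the middle, whose ends are both chosen. If the thread is
a loop of even length then the two stretches have to stop one step earlier, and the middle vertex
is chosen as well; this happens only at a vertex of degree other than three, since a loop at a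
vertex of degree three would make the third edge a bridge (`IsThread.degree_ne_three`).

A vertex of `K` of degree `d` thus accounts for at most `1 + d` vertices if `d = 3`, and for at most
`1 + 2 * d` otherwise, which in both cases is at most `9 * (d - 2) / 2` if `d ≥ 3`, and is `5` if
`d = 2`. Twice the cyclomatic number of a component of `H` is two plus the sum of all `d - 2`, and
the cyclomatic numbers of the components add up to at most `k`
(`card_edgeSet_add_card_connectedComponent_le`). If some component has a vertex of degree at least
three, this gives at most `9 * k - 9` vertices in all; otherwise there are at most `k` cycles, which
account for at most `5 * k ≤ 9 * k - 8` vertices since `k ≥ 2`.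
-/

namespace SimpleGraph

variable {V : Type*}

/-! ### Bridges and the bridgeless part -/

/-- The spanning subgraph of `G` consisting of the edges that are not bridges. -/
def bridgelessPart (G : SimpleGraph V) : SimpleGraph V :=
  G.deleteEdges {e | G.IsBridge e}

lemma bridgelessPart_adj {G : SimpleGraph V} {a b : V} :
    G.bridgelessPart.Adj a b ↔ G.Adj a b ∧ ¬ G.IsBridge s(a, b) := by
  simp [bridgelessPart]

lemma bridgelessPart_le (G : SimpleGraph V) : G.bridgelessPart ≤ G :=
  deleteEdges_le _

lemma mem_edgeSet_bridgelessPart {G : SimpleGraph V} {e : Sym2 V} :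
    e ∈ G.bridgelessPart.edgeSet ↔ e ∈ G.edgeSet ∧ ¬ G.IsBridge e := by
  simp [bridgelessPart]

lemma not_isBridge_bridgelessPart {G : SimpleGraph V} {e : Sym2 V}
    (he : e ∈ G.bridgelessPart.edgeSet) : ¬ G.bridgelessPart.IsBridge e := by
  obtain ⟨heG, hb⟩ := mem_edgeSet_bridgelessPart.1 he
  rw [isBridge_iff_forall_cycle_notMem heG] at hb
  push Not at hb
  obtain ⟨u, p, hp, hep⟩ := hb
  -- a cycle through `e` consists of edges that are not bridges
  have hH : ∀ f ∈ p.edges, f ∈ G.bridgelessPart.edgeSet := fun f hf ↦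
    mem_edgeSet_bridgelessPart.2
      ⟨p.edges_subset_edgeSet hf, fun h ↦ h.notMem_edges_of_isCycle hp hf⟩
  exact fun h ↦ h.notMem_edges_of_isCycle (hp.transfer hH) (by simpa using hep)

lemma Reachable.deleteEdges_of_bridgelessPart {G : SimpleGraph V} {e : Sym2 V} {x y : V}
    (he : G.IsBridge e) (h : G.bridgelessPart.Reachable x y) :
    (G.deleteEdges {e}).Reachable x y :=
  h.mono fun a b hab ↦ by
    rw [bridgelessPart_adj] at hab
    simp only [deleteEdges_adj, Set.mem_singleton_iff]
    exact ⟨hab.1, fun h ↦ hab.2 (h ▸ he)⟩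

/-- A path of `G` between vertices of one component of the bridgeless part uses no bridge. -/
lemma Walk.IsPath.mem_edgeSet_bridgelessPart {G : SimpleGraph V} {x y : V} {p : G.Walk x y}
    (hp : p.IsPath) (hxy : G.bridgelessPart.Reachable x y) {e : Sym2 V} (he : e ∈ p.edges) :
    e ∈ G.bridgelessPart.edgeSet := by
  refine SimpleGraph.mem_edgeSet_bridgelessPart.2 ⟨p.edges_subset_edgeSet he, fun hb ↦ ?_⟩
  induction e with | h a b =>
  have hxy' := hxy.deleteEdges_of_bridgelessPart hb
  have hab : ¬ (G.deleteEdges {s(a, b)}).Reachable a b := hb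
  by_cases hxb : (G.deleteEdges {s(a, b)}).Reachable x b
  · rw [Sym2.eq_swap] at hab hxb he hxy'
    exact hp.isTrail.not_mem_edges_of_not_reachable (fun h ↦ hab (h.symm.trans hxb))
      (fun h ↦ hab (h.symm.trans (hxy'.symm.trans hxb))) he
  · exact hp.isTrail.not_mem_edges_of_not_reachable hxb (fun h ↦ hxb (hxy'.trans h)) he

/-- Distances and shortest paths inside a component of the bridgeless part do not change when the
bridges are put back. -/
lemma Monitors.of_bridgelessPart {G : SimpleGraph V} {x y : V} {e : Sym2 V}
    (h : Monitors G.bridgelessPart x y e) : Monitors G x y e := by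
  obtain ⟨hr, hm⟩ := h
  refine ⟨hr.mono G.bridgelessPart_le, fun p hp ↦ ?_⟩
  have hpath := p.isPath_of_length_eq_dist hp
  have key := hm (p.transfer _ fun f hf ↦ hpath.mem_edgeSet_bridgelessPart hr hf) <|
    le_antisymm (by
      rw [Walk.length_transfer, hp]
      exact hr.dist_anti G.bridgelessPart_le) (dist_le _)
  simpa using key

lemma monitors_of_adj {G : SimpleGraph V} {a b : V} (h : G.Adj a b) : Monitors G a b s(a, b) := by
  refine ⟨h.reachable, fun p hp ↦ ?_⟩
  rw [dist_eq_one_iff_adj.2 h] at hp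
  cases p with
  | nil => simp at hp
  | cons _ q => cases q <;> simp_all

/-- A vertex on the `a`-side of an edge `ab` that is as far as possible from `b` among the vertices
of that side is a leaf or lies on an edge that is not a bridge. -/
lemma exists_leaf_or_bridgelessPart_adj [Fintype V] {G : SimpleGraph V} [DecidableRel G.Adj]
    (hG : G.Connected) {a b : V} (hb : G.IsBridge s(a, b)) :
    ∃ x, (G.deleteEdges {s(a, b)}).Reachable a x ∧
      (G.degree x = 1 ∨ ∃ y, G.bridgelessPart.Adj x y) := by
  classical
  obtain ⟨x, hx, hmax⟩ := Finset.exists_max_image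
    (Finset.univ.filter fun x ↦ (G.deleteEdges {s(a, b)}).Reachable a x) (fun x ↦ G.dist b x)
    ⟨a, by simp⟩
  simp only [Finset.mem_filter, Finset.mem_univ, true_and] at hx hmax
  refine ⟨x, hx, or_iff_not_imp_left.2 fun hdeg ↦ ?_⟩
  have hxb : x ≠ b := by rintro rfl; exact hb hx
  -- a neighbour `y₁` of `x` that is closer to `b`, and another neighbour `y₂`
  obtain ⟨p, hp⟩ := (hG x b).exists_walk_length_eq_dist
  cases p with
  | nil => exact absurd rfl hxb
  | @cons _ y₁ _ h₁ p =>
  have hd₁ : G.dist b y₁ < G.dist b x := by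
    have := dist_le p
    rw [Walk.length_cons] at hp
    rw [dist_comm, dist_comm (u := b) (v := x)]
    omega
  obtain ⟨y₂, h₂, hne⟩ : ∃ y₂, G.Adj x y₂ ∧ y₂ ≠ y₁ := by
    by_contra! hcon
    apply hdeg
    rw [← card_neighborFinset_eq_degree, Finset.card_eq_one]
    refine ⟨y₁, ?_⟩
    ext z
    simp only [mem_neighborFinset, Finset.mem_singleton]
    exact ⟨hcon z, fun h ↦ h ▸ h₁⟩
  have hd₂ : G.dist b y₂ ≤ G.dist b x := by
    by_cases hy : y₂ = b
    · simp [hy]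
    refine hmax _ (hx.trans (Adj.reachable ?_))
    simp only [deleteEdges_adj, Set.mem_singleton_iff, Sym2.eq_iff]
    grind
  -- shortest paths from `b` to either neighbour avoid `x`
  have avoid : ∀ y, y ≠ x → G.dist b y ≤ G.dist b x →
      (G.deleteEdges {s(x, y₂)}).Reachable b y := by
    intro y hy hd
    obtain ⟨q, hq⟩ := (hG b y).exists_walk_length_eq_dist
    by_contra hcon
    have hxq := q.fst_mem_support_of_mem_edges (q.mem_edges_of_not_reachable_deleteEdges hcon)
    have h1 := dist_le (q.takeUntil x hxq)
    have h2 := q.length_takeUntil_lt_length hxq hy.symm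
    omega
  refine ⟨y₂, bridgelessPart_adj.2 ⟨h₂, fun hbr ↦ hbr ?_⟩⟩
  refine (Adj.reachable ?_).trans
    ((avoid y₁ h₁.ne' hd₁.le).symm.trans (avoid y₂ h₂.ne' hd₂))
  simp only [deleteEdges_adj, Set.mem_singleton_iff, Sym2.eq_iff]
  grind [h₁.ne]

/-- A bridge is monitored as soon as there is a chosen vertex on either side of it, which holds if
all leaves are chosen and every nontrivial component of the bridgeless part has a chosen vertex. -/
lemma exists_monitors_of_isBridge [Fintype V] {G : SimpleGraph V} [DecidableRel G.Adj]
    (hG : G.Connected) {S : Finset V} (hleaf : ∀ v, G.degree v = 1 → v ∈ S)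
    (hS : ∀ v w, G.bridgelessPart.Adj v w → ∃ u ∈ S, G.bridgelessPart.Reachable v u)
    {e : Sym2 V} (he : G.IsBridge e) : ∃ x ∈ S, ∃ y ∈ S, Monitors G x y e := by
  have side : ∀ {a b}, G.IsBridge s(a, b) →
      ∃ x ∈ S, (G.deleteEdges {s(a, b)}).Reachable a x := by
    intro a b hb
    obtain ⟨x, hx, hx' | ⟨y, hy⟩⟩ := exists_leaf_or_bridgelessPart_adj hG hb
    · exact ⟨x, hleaf x hx', hx⟩
    · obtain ⟨u, hu, hxu⟩ := hS x y hy
      exact ⟨u, hu, hx.trans (hxu.deleteEdges_of_bridgelessPart hb)⟩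
  induction e with | h a b =>
  obtain ⟨x, hxS, hx⟩ := side he
  obtain ⟨y, hyS, hy⟩ := side (Sym2.eq_swap (a := a) ▸ he)
  rw [Sym2.eq_swap] at hy
  exact ⟨x, hxS, y, hyS, hG x y, fun p _ ↦ p.mem_edges_of_not_reachable_deleteEdges
    fun h ↦ he (hx.trans (h.trans hy.symm))⟩

/-! ### Threads -/

/-- The sequence `t 0, …, t l` is a thread of `H` between vertices of `K`: a non-backtracking walk
of positive length which starts and ends in `K` (possibly at the same vertex) and whose inner
vertices lie outside `K` and have no neighbours besides their two neighbours on the thread.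
The values of `t` beyond `l` are irrelevant. -/
structure IsThread (H : SimpleGraph V) (K : Finset V) (t : ℕ → V) (l : ℕ) : Prop where
  pos : 0 < l
  left_mem : t 0 ∈ K
  right_mem : t l ∈ K
  notMem : ∀ i, i + 1 < l → t (i + 1) ∉ K
  adj : ∀ i < l, H.Adj (t i) (t (i + 1))
  ne : ∀ i, i + 2 ≤ l → t i ≠ t (i + 2)
  eq_or_eq : ∀ i, i + 2 ≤ l → ∀ z, H.Adj (t (i + 1)) z → z = t i ∨ z = t (i + 2)
  ne_of_loop : t 0 = t l → t 1 ≠ t (l - 1)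

namespace IsThread

variable {H : SimpleGraph V} {K : Finset V} {t : ℕ → V} {l : ℕ}

lemma three_le (h : IsThread H K t l) (hl : t 0 = t l) : 3 ≤ l := by
  have h1 := h.pos
  have h2 := h.ne_of_loop hl
  rcases (by omega : l = 1 ∨ l = 2 ∨ 3 ≤ l) with rfl | rfl | h3
  · exact absurd hl (h.adj 0 h1).ne
  · simp at h2
  · exact h3

lemma reverse (h : IsThread H K t l) : IsThread H K (fun i ↦ t (l - i)) l where
  pos := h.pos
  left_mem := by simpa using h.right_mem
  right_mem := by simpa using h.left_mem
  notMem i hi := by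
    have := h.notMem (l - i - 2) (by omega)
    rwa [show l - i - 2 + 1 = l - (i + 1) by omega] at this
  adj i hi := by
    have := h.adj (l - i - 1) (by omega)
    rw [show l - i - 1 + 1 = l - i by omega] at this
    exact this.symm
  ne i hi := by
    have := h.ne (l - i - 2) (by omega)
    rw [show l - i - 2 + 2 = l - i by omega] at this
    exact this.symm
  eq_or_eq i hi z hz := by
    have := h.eq_or_eq (l - i - 2) (by omega) z
    rw [show l - i - 2 + 1 = l - (i + 1) by omega, show l - i - 2 + 2 = l - i by omega] at this
    exact (this hz).symm
  ne_of_loop hl := by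
    have := h.pos
    have h2 := h.ne_of_loop (by simpa using hl.symm)
    simpa [show l - (l - 1) = 1 by omega] using h2.symm

/-- A thread is determined by its first two vertices. -/
lemma eq_of_eq {t' : ℕ → V} {l' : ℕ} (h : IsThread H K t l) (h' : IsThread H K t' l')
    (h0 : t 0 = t' 0) (h1 : t 1 = t' 1) : l = l' ∧ ∀ i ≤ l, t i = t' i := by
  have key : ∀ i, i + 1 ≤ l → i + 1 ≤ l' → t i = t' i ∧ t (i + 1) = t' (i + 1) := by
    intro i
    induction i with
    | zero => exact fun _ _ ↦ ⟨h0, h1⟩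
    | succ i ih =>
      intro hl hl'
      obtain ⟨ha, hb⟩ := ih (by omega) (by omega)
      refine ⟨hb, ?_⟩
      have hadj := h.adj (i + 1) (by omega)
      rw [hb] at hadj
      refine (h'.eq_or_eq i (by omega) _ hadj).resolve_left fun hcon ↦ ?_
      exact h.ne i (by omega) (ha.trans hcon.symm)
  have hpos := h.pos
  have hpos' := h'.pos
  have hll : l = l' := by
    rcases lt_trichotomy l l' with hlt | heq | hlt
    · obtain ⟨j, rfl⟩ : ∃ j, l = j + 1 := ⟨l - 1, by omega⟩
      exact absurd ((key j le_rfl (by omega)).2 ▸ h.right_mem) (h'.notMem j hlt)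
    · exact heq
    · obtain ⟨j, rfl⟩ : ∃ j, l' = j + 1 := ⟨l' - 1, by omega⟩
      exact absurd ((key j (by omega) le_rfl).2.symm ▸ h'.right_mem) (h.notMem j hlt)
  subst hll
  refine ⟨rfl, fun i hi ↦ ?_⟩
  rcases hi.eq_or_lt with rfl | hi
  · obtain ⟨j, rfl⟩ : ∃ j, i = j + 1 := ⟨i - 1, by omega⟩
    exact (key j le_rfl le_rfl).2
  · exact (key i hi hi).1

open Classical in
/-- A walk from `t i` back to `t 0` that avoids an earlier edge of the thread has to run through the
rest of the thread, and needs one more step if the thread is not a loop. -/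
lemma le_length (h : IsThread H K t l) {m : ℕ} {x y : V} (q : H.Walk x y)
    (hq : s(t m, t (m + 1)) ∉ q.edges) (hy : y = t 0) {i : ℕ} (hmi : m < i) (hil : i ≤ l)
    (hx : x = t i) : l - i + (if t 0 = t l then 0 else 1) ≤ q.length := by
  induction q generalizing i with
  | nil =>
    rcases hil.eq_or_lt with rfl | hil
    · simp [← hy, hx]
    · obtain ⟨j, rfl⟩ : ∃ j, i = j + 1 := ⟨i - 1, by omega⟩
      exact absurd h.left_mem (hy ▸ hx ▸ h.notMem j hil)
  | @cons _ z _ hxz q ih =>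
    simp only [Walk.edges_cons, List.mem_cons, not_or] at hq
    rw [Walk.length_cons]
    rcases hil.eq_or_lt with rfl | hil
    · split_ifs <;> omega
    · obtain ⟨j, rfl⟩ : ∃ j, i = j + 1 := ⟨i - 1, by omega⟩
      rw [hx] at hxz hq
      rcases h.eq_or_eq j (by omega) z hxz with rfl | rfl
      · have hmj : m ≠ j := by
          rintro rfl
          exact hq.1 Sym2.eq_swap
        have := ih hq.2 hy (i := j) (by omega) (by omega) rfl
        omega
      · have := ih hq.2 hy (i := j + 2) (by omega) (by omega) rfl
        omega

open Classical in
/-- The initial stretch of a thread up to `t j` is the only shortest path between its ends, if it is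
shorter than the way around. -/
lemma monitors (h : IsThread H K t l) {j m : ℕ} (hjl : j ≤ l) (hmj : m < j)
    (hj : 2 * j < l + (if t 0 = t l then 0 else 1)) :
    Monitors H (t 0) (t j) s(t m, t (m + 1)) := by
  have hwalk : ∀ i ≤ l, ∃ q : H.Walk (t 0) (t i), q.length = i := by
    intro i
    induction i with
    | zero => exact fun _ ↦ ⟨.nil, rfl⟩
    | succ i ih =>
      intro hi
      obtain ⟨q, hq⟩ := ih (by omega)
      exact ⟨q.concat (h.adj i hi), by simp [hq]⟩
  obtain ⟨q, hq⟩ := hwalk j hjl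
  refine ⟨q.reachable, fun p hp ↦ by_contra fun hcon ↦ ?_⟩
  have h1 := dist_le q
  have h2 := h.le_length p.reverse (by simpa using hcon) rfl hmj hjl rfl
  rw [Walk.length_reverse] at h2
  omega

open Classical in
/-- The position of the farthest vertex of a thread that is certainly joined to its first vertex by
a unique shortest path: the middle, rounded down; if the thread is a loop of even length, one
before the middle, since the middle is reached both ways around. -/
noncomputable def mid (t : ℕ → V) (l : ℕ) : ℕ :=
  if t 0 = t l then (l - 1) / 2 else l / 2

lemma mid_le (t : ℕ → V) (l : ℕ) : mid t l ≤ l := by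
  unfold mid
  split_ifs <;> omega

lemma mid_reverse (t : ℕ → V) (l : ℕ) : mid (fun i ↦ t (l - i)) l = mid t l := by
  by_cases h : t 0 = t l
  · simp [mid, h]
  · simp [mid, h, Ne.symm h]

open Classical in
/-- The vertices at `mid`, seen from either end, together with the ends and, for a loop, the vertex
following the one at `mid`, monitor all edges of a thread. -/
lemma exists_monitors (h : IsThread H K t l) {S : Finset V} (h0 : t 0 ∈ S) (hl : t l ∈ S)
    (hm : t (mid t l) ∈ S) (hm' : t (l - mid t l) ∈ S)
    (hloop : t 0 = t l → t (mid t l + 1) ∈ S) {m : ℕ} (hml : m < l) :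
    ∃ x ∈ S, ∃ y ∈ S, Monitors H x y s(t m, t (m + 1)) := by
  have hpos := h.pos
  have hlt : ∀ {t : ℕ → V}, 2 * mid t l < l + (if t 0 = t l then 0 else 1) := by
    intro t
    unfold mid
    split_ifs <;> omega
  by_cases h1 : m < mid t l
  · exact ⟨_, h0, _, hm, h.monitors (mid_le _ _) h1 hlt⟩
  by_cases h2 : l - mid t l ≤ m
  · refine ⟨t l, hl, _, hm', ?_⟩
    have := h.reverse.monitors (j := mid (fun i ↦ t (l - i)) l) (m := l - m - 1) (mid_le _ _)
      (by rw [mid_reverse]; omega) hlt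
    rwa [mid_reverse, show l - (l - m - 1) = m + 1 by omega,
      show l - (l - m - 1 + 1) = m by omega, Sym2.eq_swap] at this
  -- at most two edges in the middle remain, and both ends of each of them belong to `S`
  have hadj := monitors_of_adj (h.adj m hml)
  by_cases hc : t 0 = t l
  · have hmid : mid t l = (l - 1) / 2 := by simp [mid, hc]
    rcases (by omega : m = mid t l ∨ (m = mid t l + 1 ∧ m + 1 = l - mid t l)) with rfl | ⟨rfl, h4⟩
    · exact ⟨_, hm, _, hloop hc, hadj⟩
    · exact ⟨_, hloop hc, _, h4 ▸ hm', hadj⟩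
  · have hmid : mid t l = l / 2 := by simp [mid, hc]
    obtain ⟨rfl, h4⟩ : m = mid t l ∧ m + 1 = l - mid t l := by omega
    exact ⟨_, hm, _, h4 ▸ hm', hadj⟩

/-- If a loop is attached at a vertex of degree three, then the third edge at that vertex is the
only edge leaving the loop, hence a bridge. -/
lemma degree_ne_three [Fintype V] [DecidableRel H.Adj] (h : IsThread H K t l)
    (hH : ∀ e ∈ H.edgeSet, ¬ H.IsBridge e) (hl : t 0 = t l) : H.degree (t 0) ≠ 3 := by
  classical
  intro hdeg
  have hl3 := h.three_le hl
  have ha : H.Adj (t 0) (t 1) := h.adj 0 h.pos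
  have hb : H.Adj (t 0) (t (l - 1)) := by
    have := h.adj (l - 1) (by omega)
    rw [show l - 1 + 1 = l by omega, ← hl] at this
    exact this.symm
  have hne := h.ne_of_loop hl
  obtain ⟨z, hz⟩ : ∃ z, H.neighborFinset (t 0) \ {t 1, t (l - 1)} = {z} := by
    rw [← Finset.card_eq_one, Finset.card_sdiff_of_subset (by simp [Finset.insert_subset_iff, ha, hb]),
      card_neighborFinset_eq_degree, hdeg, Finset.card_pair hne]
  have hz' : ∀ w, H.Adj (t 0) w → w = t 1 ∨ w = t (l - 1) ∨ w = z := by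
    intro w hw
    have : w ∈ H.neighborFinset (t 0) \ {t 1, t (l - 1)} ↔ w = z := by simp [hz]
    simp only [Finset.mem_sdiff, mem_neighborFinset, Finset.mem_insert, Finset.mem_singleton] at this
    tauto
  obtain ⟨hadj, hz1, hz2⟩ : H.Adj (t 0) z ∧ z ≠ t 1 ∧ z ≠ t (l - 1) := by
    have : z ∈ H.neighborFinset (t 0) \ {t 1, t (l - 1)} := by simp [hz]
    simpa using this
  set C : Set V := {v | ∃ i < l, v = t i} with hC
  have hzC : z ∉ C := by
    rintro ⟨i, hi, rfl⟩
    obtain rfl | ⟨j, rfl⟩ : i = 0 ∨ ∃ j, i = j + 1 := by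
      rcases i with _ | j <;> simp
    · exact hadj.ne rfl
    -- an inner vertex next to `t 0` is the first or the last one
    rcases h.eq_or_eq j hi (t 0) hadj.symm with h0 | h0
    · obtain rfl | ⟨k, rfl⟩ : j = 0 ∨ ∃ k, j = k + 1 := by
        rcases j with _ | k <;> simp
      · exact hz1 rfl
      · exact h.notMem k (by omega) (h0 ▸ h.left_mem)
    · rcases (show j + 2 ≤ l from hi).eq_or_lt with hj | hj
      · exact hz2 (by rw [← hj]; rfl)
      · exact h.notMem (j + 1) hj (h0 ▸ h.left_mem)
  refine hH s(t 0, z) hadj fun ⟨p⟩ ↦ ?_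
  obtain ⟨⟨⟨x, y⟩, hxy⟩, -, ⟨i, hi, hx⟩, hyC⟩ := p.exists_boundary_dart C ⟨0, h.pos, rfl⟩ hzC
  simp only at hx hyC hxy
  subst hx
  simp only [deleteEdges_adj, Set.mem_singleton_iff] at hxy
  obtain rfl | ⟨j, rfl⟩ : i = 0 ∨ ∃ j, i = j + 1 := by
    rcases i with _ | j <;> simp
  · rcases hz' y hxy.1 with rfl | rfl | rfl
    · exact hyC ⟨1, by omega, rfl⟩
    · exact hyC ⟨l - 1, by omega, rfl⟩
    · exact hxy.2 rfl
  · rcases h.eq_or_eq j hi y hxy.1 with rfl | rfl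
    · exact hyC ⟨j, by omega, rfl⟩
    · rcases (show j + 2 ≤ l from hi).eq_or_lt with hj | hj
      · exact hyC ⟨0, h.pos, by rw [hj, hl]⟩
      · exact hyC ⟨j + 2, hj, rfl⟩

end IsThread

lemma eq_or_eq_of_degree_le_two [Fintype V] {H : SimpleGraph V} [DecidableRel H.Adj] {v a b z : V}
    (hv : H.degree v ≤ 2) (ha : H.Adj v a) (hb : H.Adj v b) (hab : a ≠ b) (hz : H.Adj v z) :
    z = a ∨ z = b := by
  classical
  by_contra! hcon
  have h3 : ({a, b, z} : Finset V).card ≤ H.degree v := by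
    rw [← card_neighborFinset_eq_degree]
    refine Finset.card_le_card ?_
    simp [Finset.insert_subset_iff, ha, hb, hz]
  rw [Finset.card_eq_three.2 ⟨a, b, z, hab, hcon.1.symm, hcon.2.symm, rfl⟩] at h3
  omega

/-- A cycle meets `K` if `K` contains all vertices of degree at least three and meets every
nontrivial component: otherwise the cycle would be a whole component. -/
lemma Walk.IsCycle.exists_mem_support [Fintype V] {H : SimpleGraph V} [DecidableRel H.Adj]
    {K : Finset V} (hK : ∀ v ∉ K, H.degree v ≤ 2)
    (hreach : ∀ v w, H.Adj v w → ∃ u ∈ K, H.Reachable v u) {a : V} {c : H.Walk a a}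
    (hc : c.IsCycle) : ∃ u ∈ K, u ∈ c.support := by
  classical
  by_contra! hcon
  obtain ⟨u, huK, ⟨p⟩⟩ := hreach a _ (c.adj_snd hc.not_nil)
  obtain ⟨⟨⟨x, y⟩, hxy⟩, -, hx, hy⟩ :=
    p.exists_boundary_dart {v | v ∈ c.support} c.start_mem_support (hcon u huK)
  simp only [Set.mem_ofPred_eq] at hx hy hxy
  have hc' : (c.rotate x hx).IsCycle := (Walk.isCycle_rotate hx).2 hc
  rcases eq_or_eq_of_degree_le_two (hK x fun h ↦ hcon x h hx)
    ((c.rotate x hx).adj_snd hc'.not_nil) ((c.rotate x hx).adj_penultimate hc'.not_nil).symm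
    hc'.snd_ne_penultimate hxy with h | h <;>
  · refine hy ((c.mem_support_rotate_iff x hx).1 ?_)
    rw [h]
    exact Walk.getVert_mem_support _ _

/-- Every edge of a bridgeless graph lies on a thread: it lies on a cycle, and the vertices of `K`
cut the cycle into threads. -/
lemma exists_isThread [Fintype V] {H : SimpleGraph V} [DecidableRel H.Adj]
    {K : Finset V} (hH : ∀ e ∈ H.edgeSet, ¬ H.IsBridge e) (hK : ∀ v ∉ K, H.degree v ≤ 2)
    (hreach : ∀ v w, H.Adj v w → ∃ u ∈ K, H.Reachable v u) {e : Sym2 V} (he : e ∈ H.edgeSet) :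
    ∃ t l m, IsThread H K t l ∧ m < l ∧ e = s(t m, t (m + 1)) := by
  classical
  obtain ⟨u, c, huK, hc, hec⟩ : ∃ u, ∃ c : H.Walk u u, u ∈ K ∧ c.IsCycle ∧ e ∈ c.edges := by
    have hb := hH e he
    rw [isBridge_iff_forall_cycle_notMem he] at hb
    push Not at hb
    obtain ⟨a, c, hc, hec⟩ := hb
    obtain ⟨u, huK, hu⟩ := hc.exists_mem_support hK hreach
    exact ⟨u, c.rotate u hu, huK, (Walk.isCycle_rotate hu).2 hc,
      (c.rotate_edges u hu).mem_iff.2 hec⟩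
  have hn3 := hc.three_le_length
  set n := c.length with hn
  have hinj : ∀ i j, 1 ≤ i → i ≤ n → 1 ≤ j → j ≤ n → c.getVert i = c.getVert j → i = j :=
    fun i j h1 h2 h3 h4 h ↦ hc.getVert_injOn ⟨h1, h2⟩ ⟨h3, h4⟩ h
  have hinj' : ∀ i j, i < n → j < n → c.getVert i = c.getVert j → i = j :=
    fun i j h1 h2 h ↦ hc.getVert_injOn' (by simp only [Set.mem_ofPred_eq]; omega)
      (by simp only [Set.mem_ofPred_eq]; omega) h
  obtain ⟨m, hm, rfl⟩ : ∃ m < n, e = s(c.getVert m, c.getVert (m + 1)) := by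
    induction e with | h a b =>
    obtain ⟨i, hi, h⟩ := c.mk_mem_edges_iff_exists.1 hec
    exact ⟨i, hi, h.symm⟩
  -- the last vertex of `K` before the edge, and the first one after it
  have h0 : c.getVert 0 ∈ K := by simpa using huK
  have hex : ∃ i, m < i ∧ c.getVert i ∈ K := ⟨n, hm, by simpa [hn] using huK⟩
  obtain ⟨hml, hlK⟩ := Nat.find_spec hex
  have hln : Nat.find hex ≤ n := Nat.find_min' hex ⟨hm, by simpa [hn] using huK⟩
  have hmin : ∀ j, m < j → j < Nat.find hex → c.getVert j ∉ K :=
    fun j h1 h2 h3 ↦ Nat.find_min hex h2 ⟨h1, h3⟩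
  set r := Nat.find hex
  have hfm : Nat.findGreatest (fun i ↦ c.getVert i ∈ K) m ≤ m := Nat.findGreatest_le m
  have hfK : c.getVert (Nat.findGreatest (fun i ↦ c.getVert i ∈ K) m) ∈ K :=
    Nat.findGreatest_spec (P := fun i ↦ c.getVert i ∈ K) (Nat.zero_le m) h0
  have hmax : ∀ j, Nat.findGreatest (fun i ↦ c.getVert i ∈ K) m < j → j ≤ m → c.getVert j ∉ K :=
    fun j h1 h2 ↦ Nat.findGreatest_is_greatest h1 h2
  set f := Nat.findGreatest (fun i ↦ c.getVert i ∈ K) m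
  have hnot : ∀ j, f < j → j < r → c.getVert j ∉ K := by
    intro j h1 h2
    rcases le_or_gt j m with h | h
    · exact hmax j h1 h
    · exact hmin j h h2
  have hne : ∀ i, i + 2 ≤ n → c.getVert i ≠ c.getVert (i + 2) := by
    intro i hi h
    rcases Nat.eq_zero_or_pos i with rfl | hpos
    · have := hinj' _ _ (by omega) (by omega) h
      omega
    · have := hinj _ _ hpos (by omega) (by omega) (by omega) h
      omega
  refine ⟨fun i ↦ c.getVert (f + i), r - f, m - f,
    ⟨by omega, hfK, ?_, ?_, ?_, ?_, ?_, ?_⟩, by omega, ?_⟩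
  · rwa [show f + (r - f) = r by omega]
  · exact fun i hi ↦ hnot _ (by omega) (by omega)
  · exact fun i hi ↦ c.adj_getVert_succ (by omega)
  · exact fun i hi ↦ hne _ (by omega)
  · intro i hi z hz
    exact eq_or_eq_of_degree_le_two (hK _ (hnot _ (by omega) (by omega)))
      (c.adj_getVert_succ (i := f + i) (by omega)).symm
      (c.adj_getVert_succ (i := f + (i + 1)) (by omega)) (hne (f + i) (by omega)) hz
  · intro hl h
    simp only [add_zero, show f + (r - f) = r by omega,
      show f + (r - f - 1) = r - 1 by omega] at hl h
    -- the thread is a loop, hence the whole cycle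
    have hf0 : f = 0 := by
      by_contra hf0
      have := hinj _ _ (by omega) (by omega) (by omega) (by omega) hl
      omega
    have hrn : r = n := by
      by_contra hrn
      have := hinj' _ _ (by omega) (by omega) hl
      omega
    have := hinj' _ _ (by omega) (by omega) h
    omega
  · simp only [show f + (m - f) = m by omega, show f + (m - f + 1) = m + 1 by omega]

/-! ### Choosing two vertices per thread -/

/-- In a bridgeless graph, a set `K` that contains all vertices of degree at least three and meets
every nontrivial component extends to a set monitoring all edges, with one additional vertex for
each edge leaving a vertex of `K` of degree three, and two for each edge leaving another vertex of
`K`. -/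
lemma exists_monitoring_superset [Fintype V] {H : SimpleGraph V} [DecidableRel H.Adj]
    {K : Finset V} (hH : ∀ e ∈ H.edgeSet, ¬ H.IsBridge e) (hK : ∀ v ∉ K, H.degree v ≤ 2)
    (hreach : ∀ v w, H.Adj v w → ∃ u ∈ K, H.Reachable v u) :
    ∃ S : Finset V, K ⊆ S ∧
      S.card ≤ ∑ v ∈ K, (1 + H.degree v + if H.degree v = 3 then 0 else H.degree v) ∧
      ∀ e ∈ H.edgeSet, ∃ x ∈ S, ∃ y ∈ S, Monitors H x y e := by
  classical
  -- `x v w` is the vertex at `mid` of the thread starting with `v, w`, and `x' v w` is the next one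
  have hex : ∀ v w, ∃ p : V × V, ∀ t l, IsThread H K t l → t 0 = v → t 1 = w →
      p.1 = t (IsThread.mid t l) ∧ (t 0 = t l → p.2 = t (IsThread.mid t l + 1)) := by
    intro v w
    by_cases hvw : ∃ t l, IsThread H K t l ∧ t 0 = v ∧ t 1 = w
    · obtain ⟨t, l, h, rfl, rfl⟩ := hvw
      refine ⟨(t (IsThread.mid t l), t (IsThread.mid t l + 1)), fun t' l' h' h0 h1 ↦ ?_⟩
      obtain ⟨rfl, heq⟩ := h'.eq_of_eq h h0 h1
      have hmid : IsThread.mid t l' = IsThread.mid t' l' := by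
        simp [IsThread.mid, h0, heq l' le_rfl]
      have hle := IsThread.mid_le t' l'
      refine ⟨by rw [hmid, heq _ hle], fun hloop ↦ ?_⟩
      have h3 := h'.three_le hloop
      have hlt : IsThread.mid t' l' = (l' - 1) / 2 := by simp [IsThread.mid, hloop]
      rw [hmid, heq _ (by omega)]
    · exact ⟨(v, v), fun t l h h0 h1 ↦ absurd ⟨t, l, h, h0, h1⟩ hvw⟩
  choose p hp using hex
  let S : Finset V := K.biUnion fun v ↦ insert v
    ((H.neighborFinset v).image (fun w ↦ (p v w).1) ∪
      if H.degree v = 3 then ∅ else (H.neighborFinset v).image fun w ↦ (p v w).2)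
  have hKS : K ⊆ S := fun v hv ↦ Finset.mem_biUnion.2 ⟨v, hv, Finset.mem_insert_self _ _⟩
  have hmid : ∀ {t l}, IsThread H K t l → t (IsThread.mid t l) ∈ S := by
    intro t l h
    refine Finset.mem_biUnion.2 ⟨t 0, h.left_mem, Finset.mem_insert_of_mem
      (Finset.mem_union_left _ (Finset.mem_image.2 ⟨t 1, ?_, (hp _ _ t l h rfl rfl).1⟩))⟩
    simpa using h.adj 0 h.pos
  refine ⟨S, hKS, ?_, fun e he ↦ ?_⟩
  · refine Finset.card_biUnion_le.trans (Finset.sum_le_sum fun v _ ↦ ?_)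
    refine (Finset.card_insert_le _ _).trans ?_
    have h1 := Finset.card_union_le ((H.neighborFinset v).image (fun w ↦ (p v w).1))
      (if H.degree v = 3 then ∅ else (H.neighborFinset v).image fun w ↦ (p v w).2)
    have h2 : ((H.neighborFinset v).image (fun w ↦ (p v w).1)).card ≤ H.degree v :=
      Finset.card_image_le
    have h3 : ((H.neighborFinset v).image (fun w ↦ (p v w).2)).card ≤ H.degree v :=
      Finset.card_image_le
    split_ifs at h1 ⊢
    · simp only [Finset.card_empty] at h1
      omega
    · omega
  · obtain ⟨t, l, m, h, hm, rfl⟩ := exists_isThread hH hK hreach he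
    refine h.exists_monitors (hKS h.left_mem) (hKS h.right_mem) (hmid h) ?_ (fun hl ↦ ?_) hm
    · simpa [IsThread.mid_reverse] using hmid h.reverse
    · refine Finset.mem_biUnion.2 ⟨t 0, h.left_mem, Finset.mem_insert_of_mem
        (Finset.mem_union_right _ ?_)⟩
      rw [if_neg (h.degree_ne_three hH hl)]
      refine Finset.mem_image.2 ⟨t 1, ?_, (hp _ _ t l h rfl rfl).2 hl⟩
      simpa using h.adj 0 h.pos

/-! ### Counting -/

/-- A forest has at most as many edges as the number of vertices minus the number of components. -/
lemma IsAcyclic.card_edgeSet_add_card_connectedComponent_le [Finite V] {A : SimpleGraph V}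
    (hA : A.IsAcyclic) :
    Nat.card A.edgeSet + Nat.card A.ConnectedComponent ≤ Nat.card V := by
  induction h : Nat.card A.edgeSet generalizing A with
  | zero =>
    rw [zero_add]
    exact Nat.card_le_card_of_surjective A.connectedComponentMk Quot.mk_surjective
  | succ k ih =>
    have : Nonempty A.edgeSet := (Nat.card_pos_iff.1 (by omega)).1
    obtain ⟨e, he⟩ := this
    have hcard : Nat.card (A.deleteEdges {e}).edgeSet = k := by
      rw [edgeSet_deleteEdges, Nat.card_coe_set_eq, Set.ncard_sdiff_singleton_of_mem he,
        ← Nat.card_coe_set_eq, h]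
      rfl
    have hle : A.deleteEdges {e} ≤ A := deleteEdges_le _
    have := ih (hA.anti hle) hcard
    have hlt : Nat.card A.ConnectedComponent < Nat.card (A.deleteEdges {e}).ConnectedComponent := by
      have := Fintype.ofFinite A.ConnectedComponent
      have := Fintype.ofFinite (A.deleteEdges {e}).ConnectedComponent
      rw [Nat.card_eq_fintype_card, Nat.card_eq_fintype_card]
      refine Fintype.card_lt_of_surjective_not_injective _
        (ConnectedComponent.surjective_map_ofLE hle) fun hinj ↦ ?_
      have hb := isAcyclic_iff_forall_isBridge.1 hA he
      induction e with | h a b =>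
      refine hb (ConnectedComponent.exact (hinj ?_))
      simp only [ConnectedComponent.map_mk]
      exact ConnectedComponent.sound (Adj.reachable he)
    omega

/-- The cyclomatic number of a subgraph is at most the feedback edge set number. -/
lemma card_edgeSet_add_card_connectedComponent_le [Fintype V] (G : SimpleGraph V)
    [DecidableRel G.Adj] {H : SimpleGraph V} (hH : H ≤ G) :
    Nat.card H.edgeSet + Nat.card H.ConnectedComponent ≤ Nat.card V + fesNumber G := by
  classical
  obtain ⟨F, ⟨-, hF⟩, hcard⟩ := Nat.sInf_mem
    (s := {n : ℕ | ∃ F : Finset (Sym2 V), IsFeedbackEdgeSet G F ∧ F.card = n})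
    ⟨_, G.edgeFinset, isFeedbackEdgeSet_edgeFinset G, rfl⟩
  have hF' : (H.deleteEdges (F : Set (Sym2 V))).IsAcyclic := hF.anti (deleteEdges_mono hH)
  have h1 := hF'.card_edgeSet_add_card_connectedComponent_le
  have h2 : Nat.card H.ConnectedComponent
      ≤ Nat.card (H.deleteEdges (F : Set (Sym2 V))).ConnectedComponent :=
    Nat.card_le_card_of_surjective _
      (ConnectedComponent.surjective_map_ofLE (deleteEdges_le (F : Set (Sym2 V))))
  have h3 : Nat.card H.edgeSet
      ≤ Nat.card (H.deleteEdges (F : Set (Sym2 V))).edgeSet + F.card := by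
    rw [edgeSet_deleteEdges, Nat.card_coe_set_eq, Nat.card_coe_set_eq, ← Set.ncard_coe_finset F]
    exact Set.ncard_le_ncard_sdiff_add_ncard _ _
  change F.card = fesNumber G at hcard
  omega

lemma two_le_degree_of_not_isBridge [Fintype V] {H : SimpleGraph V} [DecidableRel H.Adj]
    (hH : ∀ e ∈ H.edgeSet, ¬ H.IsBridge e) {v w : V} (h : H.Adj v w) : 2 ≤ H.degree v := by
  classical
  have hr : (H.deleteEdges {s(v, w)}).Reachable v w := not_not.1 (hH s(v, w) h)
  obtain ⟨p⟩ := hr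
  cases p with
  | nil => exact absurd h (H.irrefl)
  | @cons _ z _ hz _ =>
    simp only [deleteEdges_adj, Set.mem_singleton_iff] at hz
    rw [← card_neighborFinset_eq_degree]
    refine Finset.one_lt_card.2 ⟨w, by simpa using h, z, by simpa using hz.1, ?_⟩
    rintro rfl
    exact hz.2 rfl

open Classical in
/-- The vertices of degree at least three, together with one vertex from each component that is a
cycle, that is, all of whose vertices have degree two. -/
noncomputable def branchVertices [Fintype V] (H : SimpleGraph V) [DecidableRel H.Adj] : Finset V :=
  Finset.univ.filter fun v ↦ 3 ≤ H.degree v ∨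
    (v = (H.connectedComponentMk v).out ∧ ∀ w, H.Reachable v w → H.degree w = 2)

lemma exists_mem_branchVertices [Fintype V] {H : SimpleGraph V} [DecidableRel H.Adj]
    (hH : ∀ e ∈ H.edgeSet, ¬ H.IsBridge e) {v w : V} (h : H.Adj v w) :
    ∃ u ∈ H.branchVertices, H.Reachable v u := by
  classical
  by_cases h3 : ∃ u, H.Reachable v u ∧ 3 ≤ H.degree u
  · obtain ⟨u, hu, h3⟩ := h3
    exact ⟨u, by simp [branchVertices, h3], hu⟩
  push Not at h3
  have hout : H.connectedComponentMk (H.connectedComponentMk v).out = H.connectedComponentMk v :=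
    Quot.out_eq _
  have hr : H.Reachable v (H.connectedComponentMk v).out := ConnectedComponent.exact hout.symm
  refine ⟨_, ?_, hr⟩
  simp only [branchVertices, Finset.mem_filter, Finset.mem_univ, true_and]
  refine Or.inr ⟨by rw [hout], fun x hx ↦ ?_⟩
  have hvx := hr.trans hx
  have hlt := h3 x hvx
  obtain ⟨y, hy⟩ : ∃ y, H.Adj x y := by
    obtain ⟨q⟩ := hvx.symm
    cases q with
    | nil => exact ⟨w, h⟩
    | cons hxy _ => exact ⟨_, hxy⟩
  have := two_le_degree_of_not_isBridge hH hy
  omega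

/-- The contribution of one component `C` to the count: `2 * cost` is compared with `9 * w`, where
`w`, the excess of the degrees over two increased by two, is twice the cyclomatic number of `C`.
The component has a vertex of degree at least three, is a cycle, or is an isolated vertex. -/
lemma component_cost [Fintype V] {H : SimpleGraph V} [DecidableRel H.Adj]
    [DecidableEq H.ConnectedComponent] (hH : ∀ e ∈ H.edgeSet, ¬ H.IsBridge e)
    (C : H.ConnectedComponent) (X w : ℤ)
    (hX : X = 2 * ∑ v ∈ H.branchVertices with H.connectedComponentMk v = C,
      (1 + (H.degree v : ℤ) + if H.degree v = 3 then 0 else (H.degree v : ℤ)))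
    (hw : w = 2 + ∑ v with H.connectedComponentMk v = C, ((H.degree v : ℤ) - 2)) :
    X ≤ 9 * w - 18 ∨ X = 5 * w := by
  by_cases h3 : ∃ u, H.connectedComponentMk u = C ∧ 3 ≤ H.degree u
  · left
    obtain ⟨u, huC, hu3⟩ := h3
    have hdeg : ∀ v, H.connectedComponentMk v = C → 2 ≤ H.degree v := by
      intro v hv
      obtain ⟨q⟩ : H.Reachable v u := ConnectedComponent.exact (hv.trans huC.symm)
      cases q with
      | nil => omega
      | cons h _ => exact two_le_degree_of_not_isBridge hH h
    have hle : ∑ v ∈ H.branchVertices with H.connectedComponentMk v = C,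
        2 * (1 + (H.degree v : ℤ) + if H.degree v = 3 then 0 else (H.degree v : ℤ))
        ≤ ∑ v with H.connectedComponentMk v = C, 9 * ((H.degree v : ℤ) - 2) := by
      refine (Finset.sum_le_sum fun v hv ↦ ?_).trans
        (Finset.sum_le_sum_of_subset_of_nonneg
          (Finset.filter_subset_filter _ (Finset.subset_univ _)) fun v hv _ ↦ ?_)
      · simp only [Finset.mem_filter, branchVertices, Finset.mem_univ, true_and] at hv
        have hv3 : 3 ≤ H.degree v := by
          rcases hv.1 with h | ⟨-, h⟩
          · exact h
          · have := h u (ConnectedComponent.exact (hv.2.trans huC.symm))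
            omega
        split_ifs <;> omega
      · have := hdeg v (Finset.mem_filter.1 hv).2
        omega
    rw [← Finset.mul_sum, ← Finset.mul_sum] at hle
    omega
  right
  push Not at h3
  have hout : H.connectedComponentMk C.out = C := Quot.out_eq _
  have hreach : ∀ {v}, H.connectedComponentMk v = C → H.Reachable C.out v :=
    fun hv ↦ ConnectedComponent.exact (hout.trans hv.symm)
  by_cases h2 : ∃ v, H.connectedComponentMk v = C ∧ H.degree v ≠ 2
  · -- an isolated vertex
    obtain ⟨v, hvC, hv2⟩ := h2
    have hno : ∀ z, ¬ H.Adj v z := by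
      intro z hz
      have := two_le_degree_of_not_isBridge hH hz
      have := h3 v hvC
      omega
    have hsub : ∀ x, H.connectedComponentMk x = C ↔ x = v := by
      refine fun x ↦ ⟨fun hx ↦ ?_, fun hx ↦ hx ▸ hvC⟩
      obtain ⟨q⟩ : H.Reachable v x := ConnectedComponent.exact (hvC.trans hx.symm)
      cases q with
      | nil => rfl
      | cons h _ => exact absurd h (hno _)
    have hd0 : H.degree v = 0 := by
      rw [← card_neighborFinset_eq_degree, Finset.card_eq_zero]
      ext z
      simpa using hno z
    have hvK : v ∉ H.branchVertices := by
      simp only [branchVertices, Finset.mem_filter, Finset.mem_univ, true_and, not_or]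
      exact ⟨by omega, fun h ↦ hv2 (h.2 v .rfl)⟩
    have e1 : (H.branchVertices.filter fun x ↦ H.connectedComponentMk x = C) = ∅ := by
      ext x
      simp only [Finset.mem_filter, hsub, Finset.notMem_empty, iff_false]
      rintro ⟨h, rfl⟩
      exact hvK h
    have e2 : (Finset.univ.filter fun x ↦ H.connectedComponentMk x = C) = {v} := by
      ext x
      simp [hsub]
    rw [hX, hw, e1, e2]
    simp [hd0]
  · -- a cycle
    push Not at h2
    have e1 : (H.branchVertices.filter fun x ↦ H.connectedComponentMk x = C) = {C.out} := by
      ext x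
      simp only [Finset.mem_filter, branchVertices, Finset.mem_univ, true_and,
        Finset.mem_singleton]
      constructor
      · rintro ⟨h | h, rfl⟩
        · have := h3 x rfl
          omega
        · exact h.1
      · rintro rfl
        exact ⟨Or.inr ⟨by rw [hout],
          fun x hx ↦ h2 x ((ConnectedComponent.sound hx).symm.trans hout)⟩, hout⟩
    have e2 : ∑ v with H.connectedComponentMk v = C, ((H.degree v : ℤ) - 2) = 0 := by
      refine Finset.sum_eq_zero fun v hv ↦ ?_
      rw [h2 v (Finset.mem_filter.1 hv).2]
      rfl
    rw [hX, hw, e1, e2]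
    simp [h2 _ hout]

/-- The total number of chosen vertices: a component with a vertex of degree at least three saves
`9` in comparison with nine times its cyclomatic number, and if there is no such component, then
each cycle costs only `5`. -/
lemma sum_branchVertices_le [Fintype V] {H : SimpleGraph V} [DecidableRel H.Adj]
    (hH : ∀ e ∈ H.edgeSet, ¬ H.IsBridge e) {k : ℕ} (hk : 2 ≤ k)
    (hcard : Nat.card H.edgeSet + Nat.card H.ConnectedComponent ≤ Nat.card V + k) :
    ((∑ v ∈ H.branchVertices, (1 + H.degree v + if H.degree v = 3 then 0 else H.degree v) : ℕ) : ℤ)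
      ≤ 9 * k - 8 := by
  classical
  have := Fintype.ofFinite H.ConnectedComponent
  have : DecidableEq H.ConnectedComponent := Classical.decEq _
  set X : H.ConnectedComponent → ℤ := fun C ↦
    2 * ∑ v ∈ H.branchVertices with H.connectedComponentMk v = C,
      (1 + (H.degree v : ℤ) + if H.degree v = 3 then 0 else (H.degree v : ℤ)) with hX
  set w : H.ConnectedComponent → ℤ := fun C ↦
    2 + ∑ v with H.connectedComponentMk v = C, ((H.degree v : ℤ) - 2) with hw
  have hXw : ∀ C, X C ≤ 9 * w C - 18 ∨ X C = 5 * w C :=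
    fun C ↦ component_cost hH C _ _ rfl rfl
  have hX0 : ∀ C, 0 ≤ X C := fun C ↦
    mul_nonneg (by norm_num) (Finset.sum_nonneg fun v _ ↦ by split_ifs <;> positivity)
  have hXsum : ∑ C, X C = 2 * ∑ v ∈ H.branchVertices,
      (1 + (H.degree v : ℤ) + if H.degree v = 3 then 0 else (H.degree v : ℤ)) := by
    rw [hX, ← Finset.mul_sum, Finset.sum_fiberwise]
  have hwsum : ∑ C, w C ≤ 2 * k := by
    have hdeg : ∑ v, (H.degree v : ℤ) = 2 * Nat.card H.edgeSet := by
      rw [Nat.card_eq_fintype_card, ← edgeFinset_card]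
      exact_mod_cast H.sum_degrees_eq_twice_card_edges
    rw [hw, Finset.sum_add_distrib, Finset.sum_fiberwise, Finset.sum_sub_distrib, hdeg]
    simp only [Finset.sum_const, Finset.card_univ, ← Nat.card_eq_fintype_card, nsmul_eq_mul]
    omega
  clear_value X w
  suffices h : ∑ C, X C ≤ 18 * k - 16 by
    rw [hXsum] at h
    push_cast
    omega
  by_cases hC : ∃ C₀, X C₀ ≤ 9 * w C₀ - 18
  · obtain ⟨C₀, hC₀⟩ := hC
    have hle : ∑ C, X C ≤ ∑ C, (9 * w C - if C = C₀ then 18 else 0) := by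
      refine Finset.sum_le_sum fun C _ ↦ ?_
      have h1 := hXw C
      have h2 := hX0 C
      split_ifs with h
      · rw [h]
        exact hC₀
      · omega
    rw [Finset.sum_sub_distrib, ← Finset.mul_sum] at hle
    simp only [Finset.sum_ite_eq', Finset.mem_univ, if_true] at hle
    omega
  · push Not at hC
    have heq : ∑ C, X C = 5 * ∑ C, w C := by
      rw [Finset.mul_sum]
      exact Finset.sum_congr rfl fun C _ ↦ (hXw C).resolve_left (hC C).not_ge
    omega

end SimpleGraph

open SimpleGraph in
theorem theorem4p3 {V : Type*} [Fintype V] (G : SimpleGraph V) [DecidableRel G.Adj]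
    (hconn : G.Connected) (hfes : 2 ≤ fesNumber G) :
    (megNumber G : ℤ) ≤ 9 * (fesNumber G : ℤ) + ((leafSet G).card : ℤ) - 8 := by
  classical
  have hH : ∀ e ∈ G.bridgelessPart.edgeSet, ¬ G.bridgelessPart.IsBridge e :=
    fun e he ↦ not_isBridge_bridgelessPart he
  obtain ⟨S, hKS, hcard, hS⟩ := exists_monitoring_superset (K := G.bridgelessPart.branchVertices) hH
    (fun v hv ↦ by
      simp only [branchVertices, Finset.mem_filter, Finset.mem_univ, true_and, not_or] at hv
      omega)
    (fun v w h ↦ exists_mem_branchVertices hH h)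
  have hmeg : IsMEGSet G (leafSet G ∪ S) := by
    intro e he
    by_cases hb : G.IsBridge e
    · refine exists_monitors_of_isBridge hconn
        (fun v hv ↦ Finset.mem_union_left _ (by simpa [leafSet] using hv)) (fun v w h ↦ ?_) hb
      obtain ⟨u, hu, hr⟩ := exists_mem_branchVertices hH h
      exact ⟨u, Finset.mem_union_right _ (hKS hu), hr⟩
    · obtain ⟨x, hx, y, hy, h⟩ := hS e (mem_edgeSet_bridgelessPart.2 ⟨he, hb⟩)
      exact ⟨x, Finset.mem_union_right _ hx, y, Finset.mem_union_right _ hy, h.of_bridgelessPart⟩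
  have h1 : megNumber G ≤ (leafSet G ∪ S).card := Nat.sInf_le ⟨_, hmeg, rfl⟩
  have h2 := Finset.card_union_le (leafSet G) S
  have h3 := sum_branchVertices_le hH hfes
    (card_edgeSet_add_card_connectedComponent_le G G.bridgelessPart_le)
  omega
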